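/- Let $q$ be a prime power with $q\equiv 1\pmod 6$, and let $\widehat{\mathbb F_q^\times}$ be the group of characters $\mathbb F_q^\times\to\mathbb C^\times$, each extended to $\mathbb F_q$ by the value $0$ at $0$ (also for the trivial character $\varepsilon$). Write $\overline A=A^{-1}$ for the complex conjugate character, let $\phi$ be the quadratic character, and let $J(A,B)=\sum_{x\in\mathbb F_q}A(x)B(1-x)$ be the Jacobi sum. For characters $A_1,\dots,A_{n+1},B_1,\dots,B_n$ and $\lambda\in\mathbb F_q$ define inductively ${}_1\mathbb P_0[A;\lambda]=\overline A(1-\lambda)$ and $${}_{n+1}\mathbb P_n\left[\begin{matrix}A_1&\cdots&A_{n+1}\\&B_1\ \cdots&B_n\end{matrix};\lambda\right]=\sum_{y\in\mathbb F_q}A_{n+1}(y)\,\overline{A_{n+1}}B_n(1-y)\;{}_{n}\mathbb P_{n-1}\left[\begin{matrix}A_1&\cdots&A_{n}\\&B_1\ \cdots&B_{n-1}\end{matrix};\lambda y\right],$$ and let $${}_{n+1}\mathbb F_n\left[\begin{matrix}A_1&\cdots&A_{n+1}\\&B_1\ \cdots&B_n\end{matrix};\lambda\right]=\frac{1}{\prod_{i=1}^nJ(A_{i+1},B_i\overline{A_{i+1}})}\;{}_{n+1}\mathbb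 P_n\left[\begin{matrix}A_1&\cdots&A_{n+1}\\&B_1\ \cdots&B_n\end{matrix};\lambda\right].$$ Let $A,\chi,\eta_3\in\widehat{\mathbb F_q^\times}$ be such that $\eta_3$ has order $3$ and none of $A^6,\ \chi^6,\ (A\chi)^3,\ (\overline A\chi)^3$ is the trivial character. Then $${}_3\mathbb F_2\left[\begin{matrix}A^3&\overline A^3&\overline\chi\\&\phi&\overline\chi^3\end{matrix};\frac34\right]=\sum_{\substack{B\in\widehat{\mathbb F_q^\times}\\B^3=A^3}}\frac{J(B\chi,\eta_3)\,J(\overline B\chi,\overline{\eta_3})}{J(B,\chi\eta_3)\,J(\overline B,\chi\overline{\eta_3})}=A(-1)\sum_{\substack{B\in\widehat{\mathbb F_q^\times}\\B^3=A^3}}\frac{J(B\chi,\overline B\chi)}{J(\eta_3\chi,\chi\overline{\eta_3})}.$$ -/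

import Mathlib

noncomputable section

/-- The finite-field period function
`ₙ₊₁ℙₙ[A₁, …, Aₙ₊₁; B₁, …, Bₙ; lam]`, defined inductively by `₁ℙ₀[A; lam] = Ā(1 - lam)` and
`ₙ₊₁ℙₙ[A₁, …, Aₙ₊₁; B₁, …, Bₙ; lam]
  = ∑ y, Aₙ₊₁(y) (Āₙ₊₁ Bₙ)(1 - y) ₙℙₙ₋₁[A₁, …, Aₙ; B₁, …, Bₙ₋₁; lam y]`.
The conjugate `Ā` of a complex character is its inverse `A⁻¹`; every `MulChar`, including the
trivial one, vanishes at `0`. -/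
def ffPeriod {F : Type*} [Field F] [Fintype F] :
    (n : ℕ) → (Fin (n + 1) → MulChar F ℂ) → (Fin n → MulChar F ℂ) → F → ℂ
  | 0, A, _, lam => (A 0)⁻¹ (1 - lam)
  | n + 1, A, B, lam =>
      ∑ y : F, A (Fin.last (n + 1)) y * ((A (Fin.last (n + 1)))⁻¹ * B (Fin.last n)) (1 - y) *
        ffPeriod n (fun i => A i.castSucc) (fun i => B i.castSucc) (lam * y)

/-- The normalized finite-field hypergeometric function
`ₙ₊₁𝔽ₙ[A₁, …, Aₙ₊₁; B₁, …, Bₙ; lam]`: the period function divided by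
`∏ᵢ J(Aᵢ₊₁, Bᵢ Āᵢ₊₁)`. -/
def ffHyp {F : Type*} [Field F] [Fintype F] (n : ℕ)
    (A : Fin (n + 1) → MulChar F ℂ) (B : Fin n → MulChar F ℂ) (lam : F) : ℂ :=
  1 / (∏ i : Fin n, jacobiSum (A i.succ) (B i * (A i.succ)⁻¹)) * ffPeriod n A B lam

/-- The quadratic character of a finite field, with complex values. -/
def quadCharC (F : Type*) [Field F] [Fintype F] [DecidableEq F] : MulChar F ℂ :=
  (quadraticChar F).ringHomComp (Int.castRingHom ℂ)

/-- The finite set of complex characters `B` with `B ^ 3 = A ^ 3`. -/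
def cubeFiber {F : Type*} [Field F] [Fintype F] (A : MulChar F ℂ) : Finset (MulChar F ℂ) :=
  (Set.toFinite {B : MulChar F ℂ | B ^ 3 = A ^ 3}).toFinset

end

/-!
The inner `₂ℙ₁[C, C⁻¹; φ; lam]` of the `₃ℙ₂` can be summed in closed form. With `x = 1 - y` it is
`∑ x, φ(x) C⁻¹(-lam x + (1 - lam) / x + 2 lam - 1)`, and the quadratic substitution for such sums
gives `J(φC, C⁻¹) ∑ C(z)` over the units `z` with `z + z⁻¹ = 2 - 4 lam`; in particular the sum
vanishes unless `-lam (1 - lam)` is a square. The outer sum is then a sum over all units `z`, and at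
`3 / 4` its argument depends on `z ^ 3` only apart from `C(z) = A ^ 3 (z)`. Detecting cubes by the
powers of `η₃` turns it into `∑ J(Bχ, B⁻¹χ)` over the `B` with `B ^ 3 = A ^ 3`.

The normalizing factor `J(χ⁻¹, χ⁻²)` is `χ(27) J(η₃χ, χη₃⁻¹)`. This instance of the Hasse–Davenport
product formula follows by summing `χ⁻¹(2 - v)` along `v ↦ v ^ 3 - 3 v`, which sends `z + z⁻¹` to
`z ^ 3 + z⁻³` and permutes the `v` not of that form. The other expression for the sum over `B` comes
from writing all Jacobi sums in terms of Gauss sums, with `g(C) g(C⁻¹) = C(-1) q`.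
-/

section QuadraticSums

variable {F R : Type*} [Field F] [Fintype F] [DecidableEq F]

lemma sum_eq_add_sum_units [AddCommMonoid R] (f : F → R) :
    ∑ x, f x = f 0 + ∑ u : Fˣ, f u := by
  rw [Fintype.sum_eq_add_sum_subtype_ne f 0, ← unitsEquivNeZero.sum_comp]
  rfl

variable [CommRing R]

lemma jacobiSum_eq_sum_units (C D : MulChar F R) :
    jacobiSum C D = ∑ u : Fˣ, C u * D (1 - u) := by
  rw [jacobiSum, sum_eq_add_sum_units, MulChar.map_zero, zero_mul, zero_add]

lemma card_filter_sq_eq (hF : ringChar F ≠ 2) (a : F) :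
    (Finset.card {x : F | x ^ 2 = a} : ℤ) = 1 + quadraticChar F a := by
  rw [add_comm, ← quadraticChar_card_sqrts hF, Set.toFinset_ofPred]

lemma card_units_mul_add_div_eq (hF : ringChar F ≠ 2) {a b : F} (ha : a ≠ 0) (hb : b ≠ 0)
    (v : F) :
    (Finset.card {x : Fˣ | a * x + b / x = v} : ℤ) =
      1 + quadraticChar F (v ^ 2 - 4 * (a * b)) := by
  have h2 : (2 : F) ≠ 0 := Ring.two_ne_zero hF
  rw [← card_filter_sq_eq hF]
  congr 1
  refine Finset.card_bij (fun x _ => 2 * a * x - v) (fun x hx => ?_) (fun x _ y _ h => ?_)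
    fun s hs => ?_
  · rw [Finset.mem_filter_univ] at hx ⊢
    rw [← hx]
    field_simp
    ring
  · exact Units.ext (mul_left_cancel₀ (mul_ne_zero h2 ha) (sub_left_inj.mp h))
  · rw [Finset.mem_filter_univ] at hs
    have hsv : s + v ≠ 0 := fun h => by
      have : 2 * 2 * (a * b) = 0 := by linear_combination (v - s) * h + hs
      simp [h2, ha, hb] at this
    refine ⟨Units.mk0 ((s + v) / (2 * a)) (div_ne_zero hsv (mul_ne_zero h2 ha)), ?_, ?_⟩
    · rw [Finset.mem_filter_univ, Units.val_mk0]
      field_simp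
      linear_combination hs
    · rw [Units.val_mk0]
      field_simp
      ring

lemma sum_comp_sq (hF : ringChar F ≠ 2) (h : F → R) :
    ∑ m : F, h (m ^ 2) = ∑ n : F, h n * (1 + (quadraticChar F n : R)) := by
  rw [← Finset.sum_fiberwise' _ (fun m : F => m ^ 2)]
  refine Finset.sum_congr rfl fun n _ => ?_
  rw [Finset.sum_const, nsmul_eq_mul, mul_comm, ← Int.cast_one, ← Int.cast_add,
    ← card_filter_sq_eq hF, Int.cast_natCast]

lemma sum_units_comp_mul_add_div (hF : ringChar F ≠ 2) {a b : F} (ha : a ≠ 0) (hb : b ≠ 0)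
    (g : F → R) :
    ∑ x : Fˣ, g (a * x + b / x) =
      ∑ v : F, g v * (1 + (quadraticChar F (v ^ 2 - 4 * (a * b)) : R)) := by
  rw [← Finset.sum_fiberwise' _ (fun x : Fˣ => a * x + b / x)]
  refine Finset.sum_congr rfl fun v _ => ?_
  rw [Finset.sum_const, nsmul_eq_mul, mul_comm, ← Int.cast_one, ← Int.cast_add,
    ← card_units_mul_add_div_eq hF ha hb, Int.cast_natCast]

lemma sum_units_quadraticChar_mul (hF : ringChar F ≠ 2) (h : F → R) :
    ∑ x : Fˣ, (quadraticChar F x : R) * h x = ∑ m : Fˣ, h (m ^ 2) - ∑ x : Fˣ, h x := by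
  have hsq := sum_comp_sq hF h
  rw [sum_eq_add_sum_units fun m => h (m ^ 2), sum_eq_add_sum_units fun n => h n * _,
    zero_pow two_ne_zero, MulChar.map_zero, Int.cast_zero, add_zero, mul_one,
    add_right_inj] at hsq
  rw [hsq, ← Finset.sum_sub_distrib]
  exact Finset.sum_congr rfl fun x _ => by ring

/-- Since `a ^ 2 * m ^ 2 + b ^ 2 / m ^ 2 = (a * m + b / m) ^ 2 - 2 * a * b`, both the sum over
squares and the sum over all units become sums over one variable `n`, weighted by
`(1 + φ n) * (1 + φ (n - 4 * a * b))` and `1 + φ (n * (n - 4 * a * b))`. -/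
lemma sum_units_quadraticChar_mul_comp (hF : ringChar F ≠ 2) {a b : F} (ha : a ≠ 0) (hb : b ≠ 0)
    (g : F → R) :
    ∑ x : Fˣ, (quadraticChar F x : R) * g (a ^ 2 * x + b ^ 2 / x) =
      ∑ n : F, g (n - 2 * (a * b)) *
        ((quadraticChar F n : R) + (quadraticChar F (n - 4 * (a * b)) : R)) := by
  have hsq : ∑ m : Fˣ, g (a ^ 2 * m ^ 2 + b ^ 2 / m ^ 2) =
      ∑ n : F, g (n - 2 * (a * b)) * (1 + (quadraticChar F (n - 4 * (a * b)) : R)) *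
        (1 + (quadraticChar F n : R)) := by
    rw [← sum_comp_sq hF fun n => g (n - 2 * (a * b)) *
        (1 + (quadraticChar F (n - 4 * (a * b)) : R)),
      ← sum_units_comp_mul_add_div hF ha hb fun w => g (w ^ 2 - 2 * (a * b))]
    refine Finset.sum_congr rfl fun m _ => congrArg g ?_
    field_simp
    ring
  have hall : ∑ x : Fˣ, g (a ^ 2 * x + b ^ 2 / x) =
      ∑ n : F, g (n - 2 * (a * b)) *
        (1 + (quadraticChar F n : R) * (quadraticChar F (n - 4 * (a * b)) : R)) := by
    rw [sum_units_comp_mul_add_div hF (pow_ne_zero 2 ha) (pow_ne_zero 2 hb),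
      ← (Equiv.subRight (2 * (a * b))).sum_comp]
    refine Finset.sum_congr rfl fun n _ => ?_
    rw [Equiv.subRight_apply, ← Int.cast_mul, ← map_mul]
    ring_nf
  rw [sum_units_quadraticChar_mul hF fun x => g (a ^ 2 * x + b ^ 2 / x), hsq, hall,
    ← Finset.sum_sub_distrib]
  exact Finset.sum_congr rfl fun n _ => by ring

lemma sum_units_quadraticChar_mul_comp_eq_zero [IsDomain R] (hR : ringChar R ≠ 2) {a b : F}
    (hab : ¬ IsSquare (a * b)) (g : F → R) :
    ∑ x : Fˣ, (quadraticChar F x : R) * g (a * x + b / x) = 0 := by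
  have ha : a ≠ 0 := fun h => hab ⟨0, by simp [h]⟩
  have hb : b ≠ 0 := fun h => hab ⟨0, by simp [h]⟩
  have hneg : ∑ x : Fˣ, (quadraticChar F x : R) * g (a * x + b / x) =
      -∑ x : Fˣ, (quadraticChar F x : R) * g (a * x + b / x) := by
    rw [← Finset.sum_neg_distrib]
    refine Fintype.sum_equiv
      ((Equiv.inv Fˣ).trans (Equiv.mulLeft (Units.mk0 (b / a) (div_ne_zero hb ha)))) _ _
      fun x => ?_
    have hφ : quadraticChar F (b / a * (x : F)⁻¹) = -quadraticChar F x := by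
      rw [show b / a * (x : F)⁻¹ = a * b * x * ((a * x)⁻¹) ^ 2 by field_simp, map_mul, map_mul,
        quadraticChar_sq_one' (inv_ne_zero (mul_ne_zero ha x.ne_zero)),
        quadraticChar_neg_one_iff_not_isSquare.mpr hab]
      ring
    have hval : a * (b / a * (x : F)⁻¹) + b / (b / a * (x : F)⁻¹) = a * x + b / x := by
      field_simp
      ring
    simp only [Equiv.trans_apply, Equiv.inv_apply, Equiv.coe_mulLeft, Units.val_mul, Units.val_mk0,
      Units.val_inv_eq_inv_val, hφ, hval, Int.cast_neg, neg_mul, neg_neg]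
  have htwo : (2 : R) * ∑ x : Fˣ, (quadraticChar F x : R) * g (a * x + b / x) = 0 := by
    linear_combination hneg
  exact (mul_eq_zero_iff_left (Ring.two_ne_zero hR)).mp htwo

end QuadraticSums

section PowerSums

variable {F R : Type*} [Field F] [CommRing R]

lemma exists_generator_apply_isPrimitiveRoot [Finite F] (η : MulChar F R) :
    ∃ g : Fˣ, (∀ u, u ∈ Subgroup.zpowers g) ∧ IsPrimitiveRoot (η g) (orderOf η) := by
  obtain ⟨g, hg⟩ := IsCyclic.exists_generator (α := Fˣ)
  refine ⟨g, hg, ?_⟩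
  have horder : orderOf (η g) = orderOf η := orderOf_eq_orderOf_iff.mpr fun n => by
    rw [← MulChar.pow_apply_coe, MulChar.eq_iff hg, MulChar.one_apply_coe]
  exact horder ▸ IsPrimitiveRoot.orderOf (η g)

lemma mulChar_apply_eq_one_iff_exists_pow_orderOf_eq [Finite F] (η : MulChar F R) (u : Fˣ) :
    η u = 1 ↔ ∃ z : Fˣ, z ^ orderOf η = u := by
  refine ⟨fun hu => ?_, ?_⟩
  · obtain ⟨g, hg, hprim⟩ := exists_generator_apply_isPrimitiveRoot η
    obtain ⟨k, rfl⟩ := mem_powers_iff_mem_zpowers.mpr (hg u)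
    obtain ⟨m, rfl⟩ := hprim.dvd_of_pow_eq_one k (by simpa using hu)
    exact ⟨g ^ m, by simp only [← pow_mul, mul_comm]⟩
  · rintro ⟨z, rfl⟩
    rw [Units.val_pow_eq_pow_val, map_pow, ← MulChar.pow_apply_coe, pow_orderOf_eq_one,
      MulChar.one_apply_coe]

variable [Fintype F] [DecidableEq F] [IsDomain R]

lemma card_units_pow_orderOf_eq (η : MulChar F R) (u : Fˣ) :
    (Finset.card {z : Fˣ | z ^ orderOf η = u} : R) = ∑ i ∈ Finset.range (orderOf η), η u ^ i := by
  set n := orderOf η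
  by_cases hu : η u = 1
  · have hrange := (mulChar_apply_eq_one_iff_exists_pow_orderOf_eq η u).mp hu
    have hcard : Finset.card {z : Fˣ | z ^ n = u} = n := calc
      _ = Finset.card {z : Fˣ | z ^ n = 1} :=
        MonoidHom.card_fiber_eq_of_mem_range (powMonoidHom n) hrange ⟨1, one_pow n⟩
      _ = Nat.card (powMonoidHom n : Fˣ →* Fˣ).ker :=
        (Nat.subtype_card _ fun z => by simp [MonoidHom.mem_ker]).symm
      _ = n := by
        rw [IsCyclic.card_powMonoidHom_ker, Nat.card_units, Nat.card_eq_fintype_card]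
        exact Nat.gcd_eq_right (MulChar.orderOf_dvd_card_sub_one F η)
    simp [hcard, hu]
  · have hempty : Finset.card {z : Fˣ | z ^ n = u} = 0 := by
      rw [Finset.card_eq_zero, Finset.filter_eq_empty_iff]
      exact fun z _ hz => hu ((mulChar_apply_eq_one_iff_exists_pow_orderOf_eq η u).mpr ⟨z, hz⟩)
    have hpow : η u ^ n = 1 := by
      rw [← MulChar.pow_apply_coe, pow_orderOf_eq_one, MulChar.one_apply_coe]
    have hgeom := geom_sum_mul (η u) n
    rw [hpow, sub_self] at hgeom
    rw [hempty, Nat.cast_zero, (mul_eq_zero_iff_right (sub_ne_zero.mpr hu)).mp hgeom]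

lemma sum_units_comp_pow_orderOf (η : MulChar F R) (h : Fˣ → R) :
    ∑ z : Fˣ, h (z ^ orderOf η) = ∑ u : Fˣ, h u * ∑ i ∈ Finset.range (orderOf η), η u ^ i := by
  rw [← Finset.sum_fiberwise' _ (fun z : Fˣ => z ^ orderOf η)]
  refine Finset.sum_congr rfl fun u _ => ?_
  rw [Finset.sum_const, nsmul_eq_mul, mul_comm, card_units_pow_orderOf_eq]

lemma sum_units_mulChar_pow_orderOf_mul (η C D : MulChar F R) :
    ∑ z : Fˣ, C (z ^ orderOf η) * D (1 - z ^ orderOf η) =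
      ∑ i ∈ Finset.range (orderOf η), jacobiSum (C * η ^ i) D := by
  have h := sum_units_comp_pow_orderOf η fun u => C u * D (1 - u)
  simp only [Units.val_pow_eq_pow_val] at h
  rw [h]
  simp_rw [Finset.mul_sum]
  rw [Finset.sum_comm]
  refine Finset.sum_congr rfl fun i _ => ?_
  rw [jacobiSum_eq_sum_units]
  refine Finset.sum_congr rfl fun u _ => ?_
  rw [MulChar.mul_apply, MulChar.pow_apply_coe]
  ring

end PowerSums

section CubeFiber

variable {F : Type*} [Field F] [Fintype F]

lemma mem_cubeFiber {A B : MulChar F ℂ} : B ∈ cubeFiber A ↔ B ^ 3 = A ^ 3 :=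
  Set.Finite.mem_toFinset _

lemma apply_neg_one_of_mem_cubeFiber {A B : MulChar F ℂ} (hB : B ∈ cubeFiber A) :
    B (-1) = A (-1) := by
  have hcube (C : MulChar F ℂ) : (C ^ 3) (-1) = C (-1) := by
    rw [MulChar.pow_apply' C three_ne_zero, ← map_pow, Odd.neg_one_pow (by decide)]
  rw [← hcube B, mem_cubeFiber.mp hB, hcube A]

lemma sum_cubeFiber {η : MulChar F ℂ} (hη : orderOf η = 3) (A : MulChar F ℂ)
    (f : MulChar F ℂ → ℂ) : ∑ B ∈ cubeFiber A, f B = ∑ i ∈ Finset.range 3, f (A * η ^ i) := by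
  symm
  refine Finset.sum_bij (fun i _ => A * η ^ i) (fun i _ => ?_) (fun i hi j hj h => ?_)
    (fun B hB => ?_) fun _ _ => rfl
  · rw [mem_cubeFiber, mul_pow, ← pow_mul, mul_comm i, pow_mul, ← hη, pow_orderOf_eq_one, one_pow,
      mul_one]
  · rw [← hη, Finset.mem_range] at hi hj
    exact pow_injOn_Iio_orderOf hi hj (mul_left_cancel h)
  · obtain ⟨g, hg, hprim⟩ := exists_generator_apply_isPrimitiveRoot η
    have hquot : (A⁻¹ * B) g ^ orderOf η = 1 := by
      rw [hη, ← MulChar.pow_apply_coe, mul_pow, inv_pow, mem_cubeFiber.mp hB, inv_mul_cancel,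
        MulChar.one_apply_coe]
    have : NeZero (orderOf η) := ⟨by simp [hη]⟩
    obtain ⟨i, hi, hig⟩ := hprim.eq_pow_of_pow_eq_one hquot
    rw [← MulChar.pow_apply_coe, ← MulChar.eq_iff hg] at hig
    exact ⟨i, Finset.mem_range.mpr (hη ▸ hi), by rw [hig, mul_inv_cancel_left]⟩

end CubeFiber

section CubicSums

variable {F R : Type*} [Field F] [Fintype F]

lemma natCast_ne_zero_of_dvd_card_sub_one {n : ℕ} (hn : n ∣ Fintype.card F - 1) :
    (n : F) ≠ 0 := fun h => by
  obtain ⟨k, hk⟩ := hn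
  have hcard : Fintype.card F = n * k + 1 := by have := Fintype.card_pos (α := F); omega
  have hzero := FiniteField.cast_card_eq_zero F
  simp [hcard, h] at hzero

lemma exists_sq_add_self_add_one_eq_zero (hq : 3 ∣ Fintype.card F - 1) :
    ∃ ω : F, ω ^ 2 + ω + 1 = 0 := by
  have : Fact (Nat.Prime 3) := ⟨Nat.prime_three⟩
  obtain ⟨u, hu⟩ := exists_prime_orderOf_dvd_card' (G := Fˣ) 3
    (by rwa [Nat.card_units, Nat.card_eq_fintype_card])
  have hprim : IsPrimitiveRoot (u : F) 3 :=
    IsPrimitiveRoot.coe_units_iff.mpr (hu ▸ IsPrimitiveRoot.orderOf u)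
  have hgeom := hprim.geom_sum_eq_zero (by norm_num)
  simp only [Finset.sum_range_succ, Finset.sum_range_zero, pow_zero, pow_one] at hgeom
  exact ⟨u, by linear_combination hgeom⟩

variable [DecidableEq F]

lemma quadraticChar_neg_three_eq_one (hq : 3 ∣ Fintype.card F - 1) :
    quadraticChar F (-3) = 1 := by
  have h3 : (3 : F) ≠ 0 := by exact_mod_cast natCast_ne_zero_of_dvd_card_sub_one hq
  obtain ⟨ω, hω⟩ := exists_sq_add_self_add_one_eq_zero hq
  rw [quadraticChar_one_iff_isSquare (neg_ne_zero.mpr h3)]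
  exact ⟨2 * ω + 1, by linear_combination -4 * hω⟩

lemma quadraticChar_cubic_sq_sub_four {v : F} (hv : v ^ 2 ≠ 1) :
    quadraticChar F ((v ^ 3 - 3 * v) ^ 2 - 4) = quadraticChar F (v ^ 2 - 4) := by
  rw [show (v ^ 3 - 3 * v) ^ 2 - 4 = (v ^ 2 - 4) * (v ^ 2 - 1) ^ 2 by ring, map_mul,
    quadraticChar_sq_one' (sub_ne_zero.mpr hv), mul_one]

lemma sq_ne_one_of_quadraticChar_sq_sub_four_ne_one (h3 : quadraticChar F (-3) = 1) {v : F}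
    (hv : quadraticChar F (v ^ 2 - 4) ≠ 1) : v ^ 2 ≠ 1 := fun h =>
  hv (by rw [h, ← h3]; norm_num)

lemma injOn_cubic (h3 : quadraticChar F (-3) = 1) :
    Set.InjOn (fun v : F => v ^ 3 - 3 * v) {v | quadraticChar F (v ^ 2 - 4) ≠ 1} := by
  intro u hu v hv huv
  by_contra hne
  have hquad : u ^ 2 + u * v + v ^ 2 = 3 :=
    mul_left_cancel₀ (sub_ne_zero.mpr hne) (by linear_combination huv)
  have hdisc : -3 * (v ^ 2 - 4) = (2 * u + v) ^ 2 := by linear_combination -4 * hquad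
  have hφ : quadraticChar F (v ^ 2 - 4) = quadraticChar F ((2 * u + v) ^ 2) := by
    rw [← hdisc, map_mul, h3, one_mul]
  by_cases h0 : 2 * u + v = 0
  · refine sq_ne_one_of_quadraticChar_sq_sub_four_ne_one h3 hu ?_
    have hneg3 : (-3 : F) ≠ 0 := fun h => by simp [h] at h3
    exact mul_left_cancel₀ hneg3 (by linear_combination (v - u) * h0 - hquad)
  · exact hv (hφ.trans (quadraticChar_sq_one' h0))

variable [CommRing R]

lemma sum_cubic_mul_one_sub_quadraticChar (h3 : quadraticChar F (-3) = 1) (g : F → R) :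
    ∑ v : F, g (v ^ 3 - 3 * v) * (1 - (quadraticChar F (v ^ 2 - 4) : R)) =
      ∑ v : F, g v * (1 - (quadraticChar F (v ^ 2 - 4) : R)) := by
  set N : Finset F := {v | quadraticChar F (v ^ 2 - 4) ≠ 1} with hN
  have hsupp (f : F → R) : ∑ v ∈ N, f v * (1 - (quadraticChar F (v ^ 2 - 4) : R)) =
      ∑ v : F, f v * (1 - (quadraticChar F (v ^ 2 - 4) : R)) :=
    Finset.sum_filter_of_ne fun v _ hv h1 => hv (by rw [h1]; simp)
  have hφ {v : F} (hv : v ∈ N) :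
      quadraticChar F ((v ^ 3 - 3 * v) ^ 2 - 4) = quadraticChar F (v ^ 2 - 4) :=
    quadraticChar_cubic_sq_sub_four <| sq_ne_one_of_quadraticChar_sq_sub_four_ne_one h3 <|
      (Finset.mem_filter_univ v).mp hv
  have hmaps : Set.MapsTo (fun v : F => v ^ 3 - 3 * v) N N := fun v hv => by
    rw [Finset.mem_coe, Finset.mem_filter_univ, hφ hv]
    exact (Finset.mem_filter_univ v).mp hv
  have hinj : Set.InjOn (fun v : F => v ^ 3 - 3 * v) N := by
    simpa [hN] using injOn_cubic h3
  rw [← hsupp fun v => g (v ^ 3 - 3 * v), ← hsupp g]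
  refine Finset.sum_nbij (fun v => v ^ 3 - 3 * v) hmaps hinj
    (Finset.surjOn_of_injOn_of_card_le _ hmaps hinj le_rfl) fun v hv => ?_
  rw [hφ hv]

lemma sum_units_add_inv_mul_inv_apply (g : F → R) (η : MulChar F R) :
    ∑ u : Fˣ, g (u + (u : F)⁻¹) * η⁻¹ u = ∑ u : Fˣ, g (u + (u : F)⁻¹) * η u := by
  refine Fintype.sum_equiv (Equiv.inv Fˣ) _ _ fun u => ?_
  rw [Equiv.inv_apply, Units.val_inv_eq_inv_val, inv_inv, add_comm, MulChar.inv_apply']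

/-- The split part of the sum is evaluated by `z + z⁻¹ ↦ z ^ 3 + (z ^ 3)⁻¹`; on the
nonsplit part `v ↦ v ^ 3 - 3 * v` is a permutation. -/
lemma sum_comp_cubic [IsDomain R] (hF : ringChar F ≠ 2) (hR : ringChar R ≠ 2)
    (h3 : quadraticChar F (-3) = 1) {η : MulChar F R} (hη : orderOf η = 3) (g : F → R) :
    ∑ v : F, g (v ^ 3 - 3 * v) = ∑ v : F, g v + ∑ u : Fˣ, g (u + (u : F)⁻¹) * η u := by
  have hadd_inv (f : F → R) : ∑ z : Fˣ, f (z + (z : F)⁻¹) =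
      ∑ v : F, f v * (1 + (quadraticChar F (v ^ 2 - 4) : R)) := by
    simpa using sum_units_comp_mul_add_div hF one_ne_zero one_ne_zero f
  have hinv : η ^ 2 = η⁻¹ :=
    (inv_eq_of_mul_eq_one_right (by rw [← pow_succ', ← pow_orderOf_eq_one η, hη])).symm
  have hcube : ∑ z : Fˣ, g ((z + (z : F)⁻¹) ^ 3 - 3 * (z + (z : F)⁻¹)) =
      ∑ z : Fˣ, g (z + (z : F)⁻¹) + 2 * ∑ u : Fˣ, g (u + (u : F)⁻¹) * η u := calc
    _ = ∑ z : Fˣ, g (((z ^ 3 : Fˣ) : F) + ((z ^ 3 : Fˣ) : F)⁻¹) :=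
      Finset.sum_congr rfl fun z _ => congrArg g (by push_cast; field_simp; ring)
    _ = ∑ u : Fˣ, g (u + (u : F)⁻¹) * (1 + η u + η⁻¹ u) := by
      rw [← hη, sum_units_comp_pow_orderOf η fun u => g (u + (u : F)⁻¹), hη]
      simp [Finset.sum_range_succ, ← hinv, MulChar.pow_apply_coe]
    _ = _ := by
      simp only [mul_add, mul_one, Finset.sum_add_distrib, sum_units_add_inv_mul_inv_apply]
      ring
  have hsplit := hadd_inv fun v => g (v ^ 3 - 3 * v)
  rw [hcube, hadd_inv] at hsplit
  have hnonsplit := sum_cubic_mul_one_sub_quadraticChar h3 g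
  simp only [mul_add, mul_sub, mul_one, Finset.sum_add_distrib, Finset.sum_sub_distrib]
    at hsplit hnonsplit
  refine mul_left_cancel₀ (Ring.two_ne_zero hR) ?_
  linear_combination hnonsplit - hsplit

end CubicSums

section JacobiSums

variable {F R : Type*} [Field F] [CommRing R]

lemma mulChar_apply_neg_one_mul_self (C : MulChar F R) : C (-1) * C (-1) = 1 := by
  rw [← map_mul, neg_one_mul, neg_neg, map_one]

variable [Fintype F]

/-- The substitution `x ↦ x / (x - 1)`. -/
lemma jacobiSum_eq_apply_neg_one_mul_jacobiSum_inv (C D : MulChar F R) :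
    jacobiSum C D = C (-1) * jacobiSum C (C * D)⁻¹ := by
  have hinj : Function.Injective fun u : F => 1 + (u - 1)⁻¹ := fun u v h => by simpa using h
  rw [jacobiSum, ← (Finite.injective_iff_bijective.mp hinj).sum_comp, jacobiSum, Finset.mul_sum]
  refine Finset.sum_congr rfl fun u _ => ?_
  rcases eq_or_ne u 1 with rfl | hu
  · simp only [sub_self, inv_zero, add_zero, MulChar.map_zero, mul_zero]
  have hu' : 1 - u ≠ 0 := sub_ne_zero.mpr hu.symm
  have hfst : 1 + (u - 1)⁻¹ = -1 * (u * (1 - u)⁻¹) := by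
    rw [← neg_sub 1 u]
    field_simp
    ring
  have hsnd : 1 - (1 + (u - 1)⁻¹) = (1 - u)⁻¹ := by rw [← neg_sub 1 u, inv_neg]; ring
  rw [hsnd, hfst]
  simp only [map_mul, MulChar.inv_apply', MulChar.mul_apply]
  ring

lemma jacobiSum_mul_inv_mul (B χ : MulChar F R) :
    jacobiSum (B * χ) (B⁻¹ * χ) = (B * χ) (-1) * jacobiSum (B * χ) (χ⁻¹ ^ 2) := by
  rw [jacobiSum_eq_apply_neg_one_mul_jacobiSum_inv, mul_mul_mul_comm, mul_inv_cancel, one_mul,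
    ← sq, inv_pow]

variable [IsDomain R]

/-- The cubic Hasse–Davenport product formula, in terms of Jacobi sums. -/
lemma jacobiSum_inv_inv_sq_of_orderOf_eq_three (hF : ringChar F ≠ 2) (hR : ringChar R ≠ 2)
    {η : MulChar F R} (hη : orderOf η = 3) {χ : MulChar F R} (hχ : χ ≠ 1) :
    jacobiSum χ⁻¹ (χ⁻¹ ^ 2) = χ 27 * jacobiSum (η * χ) (χ * η⁻¹) := by
  classical
  have hdvd : 3 ∣ Fintype.card F - 1 := hη ▸ MulChar.orderOf_dvd_card_sub_one F η
  have hneg3 := quadraticChar_neg_three_eq_one hdvd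
  have h3 : (3 : F) ≠ 0 := by exact_mod_cast natCast_ne_zero_of_dvd_card_sub_one hdvd
  have hη1 : η (-1) = 1 := MulChar.val_neg_one_eq_one_of_odd_order (n := 3) (by decide)
    (hη ▸ pow_orderOf_eq_one η)
  have hall : ∑ v : F, χ⁻¹ (2 - v) = 0 := by
    rw [← MulChar.sum_eq_zero_of_ne_one (inv_ne_one.mpr hχ)]
    exact (Equiv.subLeft (2 : F)).sum_comp (fun v => χ⁻¹ v)
  have hcubic : ∑ v : F, χ⁻¹ (2 - (v ^ 3 - 3 * v)) = χ⁻¹ 27 * jacobiSum χ⁻¹ (χ⁻¹ ^ 2) := by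
    have hinj : Function.Injective fun y : F => 2 - 3 * y := fun a b h => by simpa [h3] using h
    rw [← (Finite.injective_iff_bijective.mp hinj).sum_comp, jacobiSum, Finset.mul_sum]
    refine Finset.sum_congr rfl fun y _ => ?_
    rw [MulChar.pow_apply' _ two_ne_zero, ← map_pow, ← map_mul, ← map_mul]
    congr 1
    ring
  have hsplit : ∑ u : Fˣ, χ⁻¹ (2 - (u + (u : F)⁻¹)) * η u = jacobiSum (η * χ) (χ * η⁻¹) := by
    rw [mul_comm χ η⁻¹, jacobiSum_mul_inv_mul, jacobiSum_eq_sum_units, Finset.mul_sum]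
    refine Finset.sum_congr rfl fun w _ => ?_
    have hw : (2 : F) - (w + (w : F)⁻¹) = (-1 * (w : F))⁻¹ * (1 - w) ^ 2 := by
      field_simp
      ring
    rw [hw, map_mul χ⁻¹, MulChar.inv_apply', inv_inv, map_mul, map_pow, MulChar.mul_apply,
      MulChar.mul_apply, hη1, MulChar.pow_apply' _ two_ne_zero]
    ring
  have hsum := sum_comp_cubic hF hR hneg3 hη fun v => χ⁻¹ (2 - v)
  rw [hall, hcubic, hsplit, zero_add] at hsum
  have h27 : χ 27 * χ⁻¹ 27 = 1 := by
    rw [show (27 : F) = 3 ^ 3 by norm_num, ← MulChar.mul_apply, mul_inv_cancel,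
      MulChar.one_apply (pow_ne_zero 3 h3).isUnit]
  rw [← hsum, ← mul_assoc, h27, one_mul]

end JacobiSums

section GaussSums

variable {F K : Type*} [Field F] [Fintype F] [Field K] {ψ : AddChar F K}

lemma gaussSum_ne_zero_of_isPrimitive (hF : (Fintype.card F : K) ≠ 0) (hψ : ψ.IsPrimitive)
    (C : MulChar F K) : gaussSum C ψ ≠ 0 := by
  classical
  rcases eq_or_ne C 1 with rfl | hC
  · have hψ1 : ψ ≠ 1 := by simpa using hψ one_ne_zero
    rw [gaussSum_one_left hψ1]
    exact neg_ne_zero.mpr one_ne_zero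
  · exact gaussSum_ne_zero_of_nontrivial hF hC hψ

lemma gaussSum_mul_gaussSum_inv (hψ : ψ.IsPrimitive) {C : MulChar F K} (hC : C ≠ 1) :
    gaussSum C ψ * gaussSum C⁻¹ ψ = C (-1) * Fintype.card F := by
  rw [← gaussSum_mul_gaussSum_eq_card hC hψ, ← mul_gaussSum_inv_eq_gaussSum C⁻¹ ψ,
    MulChar.inv_apply', inv_neg_one]
  ring

lemma jacobiSum_ne_zero (hF : (Fintype.card F : K) ≠ 0) (hψ : ψ.IsPrimitive) {a : MulChar F K}
    (ha : a ≠ 1) (b : MulChar F K) : jacobiSum a b ≠ 0 := by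
  by_cases hab : a * b = 1
  · rw [eq_inv_of_mul_eq_one_right hab, jacobiSum_nontrivial_inv ha]
    exact neg_ne_zero.mpr (left_ne_zero_of_mul_eq_one (mulChar_apply_neg_one_mul_self a))
  · refine right_ne_zero_of_mul (a := gaussSum (a * b) ψ) ?_
    rw [jacobiSum_mul_nontrivial hab]
    exact mul_ne_zero (gaussSum_ne_zero_of_isPrimitive hF hψ a)
      (gaussSum_ne_zero_of_isPrimitive hF hψ b)

lemma jacobiSum_div_jacobiSum_of_mul_ne_one (hF : (Fintype.card F : K) ≠ 0) (hψ : ψ.IsPrimitive)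
    {a b c d : MulChar F K} (h : a * b = c * d) (hab : a * b ≠ 1) :
    jacobiSum a b / jacobiSum c d =
      gaussSum a ψ * gaussSum b ψ / (gaussSum c ψ * gaussSum d ψ) := by
  have hg := gaussSum_ne_zero_of_isPrimitive hF hψ (c * d)
  rw [← mul_div_mul_left _ _ hg, jacobiSum_mul_nontrivial (h ▸ hab) ψ, ← h,
    jacobiSum_mul_nontrivial hab ψ]

/-- In the case `a * b = 1`, where `J(a, a⁻¹) = -a(-1)` while `g(a) g(a⁻¹) = a(-1) q`, the factor
`-q` is common to the pairs `a, b` and `c, d`. -/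
lemma jacobiSum_div_jacobiSum (hF : (Fintype.card F : K) ≠ 0) (hψ : ψ.IsPrimitive)
    {a b c d : MulChar F K} (h : a * b = c * d) (ha : a ≠ 1) (hc : c ≠ 1) :
    jacobiSum a b / jacobiSum c d =
      gaussSum a ψ * gaussSum b ψ / (gaussSum c ψ * gaussSum d ψ) := by
  by_cases hab : a * b = 1
  · obtain rfl : b = a⁻¹ := eq_inv_of_mul_eq_one_right hab
    obtain rfl : d = c⁻¹ := eq_inv_of_mul_eq_one_right (h ▸ hab)
    rw [jacobiSum_nontrivial_inv ha, jacobiSum_nontrivial_inv hc, neg_div_neg_eq,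
      gaussSum_mul_gaussSum_inv hψ ha, gaussSum_mul_gaussSum_inv hψ hc, mul_div_mul_right _ _ hF]
  · exact jacobiSum_div_jacobiSum_of_mul_ne_one hF hψ h hab

lemma jacobiSum_mul_jacobiSum_div_eq (hF : (Fintype.card F : K) ≠ 0) (hψ : ψ.IsPrimitive)
    {B χ η : MulChar F K} (hB : B ≠ 1) (hη : η ≠ 1) (hχ : χ ^ 2 ≠ 1) :
    jacobiSum (B * χ) η * jacobiSum (B⁻¹ * χ) η⁻¹ /
        (jacobiSum B (χ * η) * jacobiSum B⁻¹ (χ * η⁻¹)) =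
      η (-1) * B (-1) * (jacobiSum (B * χ) (B⁻¹ * χ) / jacobiSum (η * χ) (χ * η⁻¹)) := by
  have hB_sq : B * χ * (B⁻¹ * χ) = χ ^ 2 := by
    rw [mul_mul_mul_comm, mul_inv_cancel, one_mul, sq]
  have hη_sq : η * χ * (χ * η⁻¹) = χ ^ 2 := by
    rw [mul_comm χ, mul_mul_mul_comm, mul_inv_cancel, one_mul, sq]
  have hsign : η (-1) / B (-1) = η (-1) * B (-1) := by
    rw [div_eq_mul_inv, inv_eq_of_mul_eq_one_left (mulChar_apply_neg_one_mul_self B)]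
  calc
    _ = jacobiSum η (B * χ) / jacobiSum B (χ * η) *
        (jacobiSum η⁻¹ (B⁻¹ * χ) / jacobiSum B⁻¹ (χ * η⁻¹)) := by
      rw [jacobiSum_comm _ η, jacobiSum_comm _ η⁻¹, mul_div_mul_comm]
    _ = gaussSum η ψ * gaussSum (B * χ) ψ / (gaussSum B ψ * gaussSum (χ * η) ψ) *
        (gaussSum η⁻¹ ψ * gaussSum (B⁻¹ * χ) ψ / (gaussSum B⁻¹ ψ * gaussSum (χ * η⁻¹) ψ)) := by
      rw [jacobiSum_div_jacobiSum hF hψ (by rw [mul_comm, mul_assoc]) hη hB,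
        jacobiSum_div_jacobiSum hF hψ (by rw [mul_comm, mul_assoc]) (inv_ne_one.mpr hη)
          (inv_ne_one.mpr hB)]
    _ = gaussSum η ψ * gaussSum η⁻¹ ψ / (gaussSum B ψ * gaussSum B⁻¹ ψ) *
        (gaussSum (B * χ) ψ * gaussSum (B⁻¹ * χ) ψ /
          (gaussSum (η * χ) ψ * gaussSum (χ * η⁻¹) ψ)) := by
      rw [mul_comm η χ]
      ring
    _ = _ := by
      rw [gaussSum_mul_gaussSum_inv hψ hη, gaussSum_mul_gaussSum_inv hψ hB,
        mul_div_mul_right _ _ hF, hsign,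
        jacobiSum_div_jacobiSum_of_mul_ne_one hF hψ (hB_sq.trans hη_sq.symm) (hB_sq ▸ hχ)]

end GaussSums

section PeriodFunctions

variable {F : Type*} [Field F]

lemma exists_add_inv_eq_two_sub_iff (hF : ringChar F ≠ 2) (lam : F) :
    (∃ z : Fˣ, (z : F) + (z : F)⁻¹ = 2 - 4 * lam) ↔ IsSquare (-lam * (1 - lam)) := by
  have h2 : (2 : F) ≠ 0 := Ring.two_ne_zero hF
  constructor
  · rintro ⟨z, hz⟩
    have hlam : lam = (2 - (z + (z : F)⁻¹)) / (2 * 2) := by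
      rw [hz]
      field_simp
      ring
    refine ⟨(z - (z : F)⁻¹) / (2 * 2), ?_⟩
    rw [hlam]
    field_simp
    ring
  · rintro ⟨s, hs⟩
    have hmul : (1 - 2 * lam + 2 * s) * (1 - 2 * lam - 2 * s) = 1 := by
      linear_combination 4 * hs
    refine ⟨Units.mkOfMulEqOne _ _ hmul, ?_⟩
    rw [Units.val_mkOfMulEqOne, inv_eq_of_mul_eq_one_right hmul]
    ring

variable [Fintype F]

lemma sum_mulChar_sub_mul_mulChar_sub {R : Type*} [CommRing R] (C D : MulChar F R) {b c : F}
    (hbc : b ≠ c) :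
    ∑ n : F, C (n - b) * D (n - c) = C (c - b) * D (b - c) * jacobiSum C D := by
  have hinj : Function.Injective fun x : F => b + (c - b) * x := fun x y h => by
    simpa [sub_ne_zero.mpr hbc.symm] using h
  rw [← (Finite.injective_iff_bijective.mp hinj).sum_comp, jacobiSum, Finset.mul_sum]
  refine Finset.sum_congr rfl fun x _ => ?_
  rw [show b + (c - b) * x - b = (c - b) * x by ring,
    show b + (c - b) * x - c = (b - c) * (1 - x) by ring, map_mul, map_mul]
  ring

variable [DecidableEq F]

lemma quadCharC_ne_one (hF : ringChar F ≠ 2) : quadCharC F ≠ 1 :=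
  (MulChar.ringHomComp_ne_one_iff (RingHom.injective_int (Int.castRingHom ℂ))).mpr
    (quadraticChar_ne_one hF)

lemma quadCharC_apply (a : F) : quadCharC F a = (quadraticChar F a : ℂ) := rfl

lemma quadCharC_sq {a : F} (ha : a ≠ 0) : quadCharC F (a ^ 2) = 1 := by
  rw [quadCharC_apply, quadraticChar_sq_one' ha, Int.cast_one]

lemma inv_quadCharC : (quadCharC F)⁻¹ = quadCharC F :=
  (MulChar.IsQuadratic.comp (quadraticChar_isQuadratic F) _).inv

lemma jacobiSum_quadCharC_inv (C : MulChar F ℂ) :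
    jacobiSum (quadCharC F) C⁻¹ = C (-1) * jacobiSum (quadCharC F * C) C⁻¹ := by
  rw [jacobiSum_comm, jacobiSum_eq_apply_neg_one_mul_jacobiSum_inv, MulChar.inv_apply',
    inv_neg_one, mul_inv_rev, inv_inv, inv_quadCharC, jacobiSum_comm]

lemma ffPeriod_one_inv_eq_sum_units (C : MulChar F ℂ) (lam : F) :
    ffPeriod 1 ![C, C⁻¹] ![quadCharC F] lam =
      ∑ x : Fˣ, (quadraticChar F x : ℂ) *
        C⁻¹ (-lam * x + (1 - lam) / x + (2 * lam - 1)) := by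
  have hunfold : ffPeriod 1 ![C, C⁻¹] ![quadCharC F] lam =
      ∑ y : F, C⁻¹ y * (C⁻¹⁻¹ * quadCharC F) (1 - y) * C⁻¹ (1 - lam * y) := rfl
  rw [hunfold, ← (Equiv.subLeft (1 : F)).sum_comp, sum_eq_add_sum_units]
  simp only [Equiv.subLeft_apply, sub_zero, sub_self, sub_sub_cancel, inv_inv, MulChar.map_zero,
    mul_zero, zero_mul, zero_add]
  refine Finset.sum_congr rfl fun x _ => ?_
  have harg : -lam * x + (1 - lam) / x + (2 * lam - 1) =
      (1 - (x : F)) * (1 - lam * (1 - x)) * (x : F)⁻¹ := by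
    field_simp
    ring
  rw [harg, map_mul, map_mul, MulChar.inv_apply' C (x : F)⁻¹, inv_inv, MulChar.mul_apply,
    quadCharC_apply]
  ring

/-- Since `4 z lam = -(1 - z) ^ 2` and `4 z (1 - lam) = (1 + z) ^ 2`, the argument of `C⁻¹` in
`ffPeriod_one_inv_eq_sum_units` is `((1 - z) ^ 2 x + (1 + z) ^ 2 / x - 2 - 2 z ^ 2) / (4 z)`. -/
lemma ffPeriod_one_inv_eq_mul_sum (hF : ringChar F ≠ 2) (C : MulChar F ℂ) {lam : F} {z : Fˣ}
    (hz : (z : F) + (z : F)⁻¹ = 2 - 4 * lam) (hz1 : 1 - (z : F) ^ 2 ≠ 0) :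
    ffPeriod 1 ![C, C⁻¹] ![quadCharC F] lam =
      C (4 * z) * (∑ n, quadCharC F n * C⁻¹ (n - 4) +
        ∑ n, quadCharC F (n - 4 * (1 - (z : F) ^ 2)) * C⁻¹ (n - 4)) := by
  have hab : (1 - (z : F)) * (1 + z) = 1 - z ^ 2 := by ring
  have h2 : (2 : F) ≠ 0 := Ring.two_ne_zero hF
  have hlam : lam = (2 - (z + (z : F)⁻¹)) / (2 * 2) := by rw [hz]; field_simp; ring
  have harg (x : Fˣ) : -lam * x + (1 - lam) / x + (2 * lam - 1) =
      ((1 - (z : F)) ^ 2 * x + (1 + z) ^ 2 / x - 2 - 2 * z ^ 2) / (4 * z) := by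
    rw [hlam, show (4 : F) = 2 * 2 by norm_num]
    field_simp
    ring
  rw [ffPeriod_one_inv_eq_sum_units]
  simp_rw [harg]
  rw [sum_units_quadraticChar_mul_comp hF (left_ne_zero_of_mul (hab ▸ hz1))
    (right_ne_zero_of_mul (hab ▸ hz1)) fun v => C⁻¹ ((v - 2 - 2 * z ^ 2) / (4 * z)), hab,
    ← Finset.sum_add_distrib, Finset.mul_sum]
  refine Finset.sum_congr rfl fun n _ => ?_
  rw [show n - 2 * (1 - (z : F) ^ 2) - 2 - 2 * (z : F) ^ 2 = n - 4 by ring, div_eq_inv_mul,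
    map_mul, MulChar.inv_apply' C (4 * z : F)⁻¹, inv_inv, quadCharC_apply, quadCharC_apply]
  ring

lemma ffPeriod_one_inv_of_add_inv_eq (hF : ringChar F ≠ 2) (C : MulChar F ℂ) {lam : F} {z : Fˣ}
    (hz : (z : F) + (z : F)⁻¹ = 2 - 4 * lam) (hz1 : 1 - (z : F) ^ 2 ≠ 0) :
    ffPeriod 1 ![C, C⁻¹] ![quadCharC F] lam =
      jacobiSum (quadCharC F * C) C⁻¹ * (C z + C (z : F)⁻¹) := by
  have h2 : (2 : F) ≠ 0 := Ring.two_ne_zero hF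
  have h4 : (2 : F) ^ 2 = 4 := by norm_num
  have h4' : (4 : F) ≠ 0 := h4 ▸ pow_ne_zero 2 h2
  have hfst : ∑ n, quadCharC F n * C⁻¹ (n - 4) = C⁻¹ (-4) * jacobiSum (quadCharC F) C⁻¹ := by
    have h := sum_mulChar_sub_mul_mulChar_sub (quadCharC F) C⁻¹ h4'.symm
    simp only [sub_zero, zero_sub] at h
    rw [h, ← h4, quadCharC_sq h2, one_mul]
  have hsnd : ∑ n, quadCharC F (n - 4 * (1 - (z : F) ^ 2)) * C⁻¹ (n - 4) =
      C⁻¹ (-4 * z ^ 2) * jacobiSum (quadCharC F) C⁻¹ := by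
    have hne : 4 * (1 - (z : F) ^ 2) ≠ 4 := fun h =>
      mul_ne_zero h4' (pow_ne_zero 2 z.ne_zero) (by linear_combination -h)
    rw [sum_mulChar_sub_mul_mulChar_sub _ _ hne,
      show 4 - 4 * (1 - (z : F) ^ 2) = (2 * z) ^ 2 by ring,
      quadCharC_sq (mul_ne_zero h2 z.ne_zero), one_mul]
    ring_nf
  have hC : C (4 * z) * C⁻¹ (-4) = C (-1) * C z := by
    rw [MulChar.inv_apply', ← map_mul, ← map_mul]
    congr 1
    field_simp
  have hC' : C (4 * z) * C⁻¹ (-4 * z ^ 2) = C (-1) * C (z : F)⁻¹ := by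
    rw [MulChar.inv_apply', ← map_mul, ← map_mul]
    congr 1
    field_simp
  rw [ffPeriod_one_inv_eq_mul_sum hF C hz hz1, hfst, hsnd, jacobiSum_quadCharC_inv]
  linear_combination C (-1) * jacobiSum (quadCharC F * C) C⁻¹ * (hC + hC') +
    jacobiSum (quadCharC F * C) C⁻¹ * (C z + C (z : F)⁻¹) * mulChar_apply_neg_one_mul_self C

lemma ffPeriod_one_inv_one (C : MulChar F ℂ) :
    ffPeriod 1 ![C, C⁻¹] ![quadCharC F] 1 = jacobiSum (quadCharC F * C) C⁻¹ * C (-1) := by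
  rw [mul_comm, ← jacobiSum_quadCharC_inv, ffPeriod_one_inv_eq_sum_units, jacobiSum_eq_sum_units]
  refine Finset.sum_congr rfl fun x _ => ?_
  rw [quadCharC_apply]
  ring_nf

lemma ffPeriod_one_inv_eq_zero (C : MulChar F ℂ) {lam : F} (hlam : ¬ IsSquare (-lam * (1 - lam))) :
    ffPeriod 1 ![C, C⁻¹] ![quadCharC F] lam = 0 := by
  rw [ffPeriod_one_inv_eq_sum_units]
  exact sum_units_quadraticChar_mul_comp_eq_zero (by simp [ringChar.eq_zero]) hlam
    fun v => C⁻¹ (v + (2 * lam - 1))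

lemma filter_add_inv_eq (z : Fˣ) :
    ({w : Fˣ | (w : F) + (w : F)⁻¹ = z + (z : F)⁻¹} : Finset Fˣ) = {z, z⁻¹} := by
  ext w
  rw [Finset.mem_filter_univ, Finset.mem_insert, Finset.mem_singleton]
  constructor
  · intro h
    have hmul : ((w : F) - z) * (w - (z : F)⁻¹) = 0 := by
      linear_combination (w : F) * h - mul_inv_cancel₀ w.ne_zero + mul_inv_cancel₀ z.ne_zero
    rw [mul_eq_zero, sub_eq_zero, sub_eq_zero, ← Units.val_inv_eq_inv_val] at hmul
    simpa only [Units.ext_iff] using hmul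
  · rintro (rfl | rfl)
    · rfl
    · rw [Units.val_inv_eq_inv_val, inv_inv, add_comm]

lemma ffPeriod_one_inv (hF : ringChar F ≠ 2) (C : MulChar F ℂ) {lam : F} (hlam : lam ≠ 0) :
    ffPeriod 1 ![C, C⁻¹] ![quadCharC F] lam = jacobiSum (quadCharC F * C) C⁻¹ *
      ∑ z ∈ {z : Fˣ | (z : F) + (z : F)⁻¹ = 2 - 4 * lam}, C z := by
  by_cases hsq : IsSquare (-lam * (1 - lam))
  · obtain ⟨z, hz⟩ := (exists_add_inv_eq_two_sub_iff hF lam).mpr hsq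
    have h2 : (2 : F) ≠ 0 := Ring.two_ne_zero hF
    have hlam' : lam = (2 - (z + (z : F)⁻¹)) / (2 * 2) := by
      rw [hz]
      field_simp
      ring
    have hz1 : z ≠ 1 := by
      rintro rfl
      exact hlam (by rw [hlam', Units.val_one]; norm_num)
    rw [← hz, filter_add_inv_eq]
    rcases eq_or_ne z (-1) with rfl | hz2
    · have hlam1 : lam = 1 := by
        rw [hlam', Units.val_neg, Units.val_one, inv_neg_one, div_eq_one_iff_eq (mul_ne_zero h2 h2)]
        norm_num
      rw [hlam1, ffPeriod_one_inv_one, inv_neg_one, Finset.pair_eq_singleton,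
        Finset.sum_singleton, Units.val_neg, Units.val_one]
    · have hzsq : (z : F) ^ 2 ≠ 1 := by
        rw [Ne, sq, mul_self_eq_one_iff, not_or]
        exact ⟨fun h => hz1 (Units.ext h), fun h => hz2 (Units.ext h)⟩
      have hz_ne_inv : z ≠ z⁻¹ := fun h => hzsq <| by
        rw [sq, ← Units.val_mul, mul_eq_one_iff_eq_inv.mpr h, Units.val_one]
      rw [Finset.sum_pair hz_ne_inv, Units.val_inv_eq_inv_val]
      exact ffPeriod_one_inv_of_add_inv_eq hF C hz (sub_ne_zero.mpr hzsq.symm)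
  · rw [ffPeriod_one_inv_eq_zero C hsq, Finset.filter_eq_empty_iff.mpr, Finset.sum_empty, mul_zero]
    exact fun z _ hz => hsq ((exists_add_inv_eq_two_sub_iff hF lam).mp ⟨z, hz⟩)

lemma sum_mul_ffPeriod_one_inv (hF : ringChar F ≠ 2) (C : MulChar F ℂ) {f : F → ℂ} (hf : f 0 = 0)
    {a : F} (ha : a ≠ 0) :
    ∑ y : F, f y * ffPeriod 1 ![C, C⁻¹] ![quadCharC F] (a * y) =
      jacobiSum (quadCharC F * C) C⁻¹ *
        ∑ z : Fˣ, C z * f ((2 - (z + (z : F)⁻¹)) / (4 * a)) := by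
  have h4a : 4 * a ≠ 0 := by
    rw [show (4 : F) = 2 ^ 2 by norm_num]
    exact mul_ne_zero (pow_ne_zero 2 (Ring.two_ne_zero hF)) ha
  rw [← Finset.sum_fiberwise _ (fun z : Fˣ => (2 - (z + (z : F)⁻¹)) / (4 * a)), Finset.mul_sum]
  refine Finset.sum_congr rfl fun y _ => ?_
  have hfiber (z : Fˣ) : (2 - (z + (z : F)⁻¹)) / (4 * a) = y ↔
      (z : F) + (z : F)⁻¹ = 2 - 4 * (a * y) := by
    rw [div_eq_iff h4a]
    constructor <;> intro h <;> linear_combination -h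
  have hconst : ∑ z ∈ {z : Fˣ | (2 - (z + (z : F)⁻¹)) / (4 * a) = y},
      C z * f ((2 - (z + (z : F)⁻¹)) / (4 * a)) =
        (∑ z ∈ {z : Fˣ | (z : F) + (z : F)⁻¹ = 2 - 4 * (a * y)}, C z) * f y := by
    simp_rw [hfiber, Finset.sum_mul]
    refine Finset.sum_congr rfl fun z hz => ?_
    rw [(hfiber z).mpr ((Finset.mem_filter_univ z).mp hz)]
  rw [hconst]
  rcases eq_or_ne y 0 with rfl | hy
  · rw [hf, zero_mul, mul_zero, mul_zero]
  · rw [ffPeriod_one_inv hF C (mul_ne_zero ha hy)]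
    ring

/-- At `3 / 4` the substitution `y = (2 - z - z⁻¹) / 3` makes `y * (1 - y) ^ 2` a function of
`z ^ 3`. -/
lemma ffPeriod_two_three_quarters (hF : ringChar F ≠ 2) (h3 : (3 : F) ≠ 0) (C χ : MulChar F ℂ) :
    ffPeriod 2 ![C, C⁻¹, χ⁻¹] ![quadCharC F, χ⁻¹ ^ 3] (3 / 4 : F) =
      jacobiSum (quadCharC F * C) C⁻¹ *
        (χ (-27) * ∑ z : Fˣ, (C * χ ^ 3) z * (χ⁻¹ ^ 2) (1 - z ^ 3)) := by
  have h4 : (4 : F) ≠ 0 := by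
    rw [show (4 : F) = 2 ^ 2 by norm_num]
    exact pow_ne_zero 2 (Ring.two_ne_zero hF)
  have hunfold : ffPeriod 2 ![C, C⁻¹, χ⁻¹] ![quadCharC F, χ⁻¹ ^ 3] (3 / 4 : F) =
      ∑ y : F, χ⁻¹ y * (χ⁻¹⁻¹ * χ⁻¹ ^ 3) (1 - y) *
        ffPeriod 1 ![C, C⁻¹] ![quadCharC F] (3 / 4 * y) := rfl
  rw [hunfold, pow_succ' χ⁻¹ 2, inv_mul_cancel_left,
    sum_mul_ffPeriod_one_inv hF C (f := fun y => χ⁻¹ y * (χ⁻¹ ^ 2) (1 - y))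
      (by rw [MulChar.map_zero, zero_mul]) (div_ne_zero h3 h4), mul_div_cancel₀ _ h4]
  congr 1
  rw [Finset.mul_sum]
  refine Finset.sum_congr rfl fun z _ => ?_
  have hcube : (2 - ((z : F) + (z : F)⁻¹)) / 3 * (1 - (2 - (z + (z : F)⁻¹)) / 3) ^ 2 =
      (-27 * (z : F) ^ 3)⁻¹ * (1 - (z : F) ^ 3) ^ 2 := by
    rw [show (-27 : F) = -(3 ^ 3) by norm_num]
    field_simp
    ring
  rw [MulChar.pow_apply' _ two_ne_zero, MulChar.pow_apply' _ two_ne_zero, ← map_pow, ← map_mul,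
    hcube, map_mul, MulChar.inv_apply' χ (-27 * (z : F) ^ 3)⁻¹, inv_inv, map_mul, map_pow, map_pow,
    MulChar.mul_apply, MulChar.pow_apply' _ three_ne_zero]
  ring

lemma sum_units_eq_sum_cubeFiber {η : MulChar F ℂ} (hη : orderOf η = 3) (A χ : MulChar F ℂ) :
    ∑ z : Fˣ, (A ^ 3 * χ ^ 3) z * (χ⁻¹ ^ 2) (1 - z ^ 3) =
      A (-1) * χ (-1) * ∑ B ∈ cubeFiber A, jacobiSum (B * χ) (B⁻¹ * χ) := by
  have hreflect (B : MulChar F ℂ) (hB : B ∈ cubeFiber A) :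
      A (-1) * χ (-1) * jacobiSum (B * χ) (B⁻¹ * χ) = jacobiSum (B * χ) (χ⁻¹ ^ 2) := by
    rw [jacobiSum_mul_inv_mul, ← apply_neg_one_of_mem_cubeFiber hB, ← MulChar.mul_apply,
      ← mul_assoc, mulChar_apply_neg_one_mul_self, one_mul]
  have hpow := sum_units_mulChar_pow_orderOf_mul η (A * χ) (χ⁻¹ ^ 2)
  rw [hη] at hpow
  rw [Finset.mul_sum, Finset.sum_congr rfl hreflect, sum_cubeFiber hη]
  simp_rw [mul_right_comm A _ χ]
  rw [← hpow]
  simp_rw [← mul_pow, MulChar.pow_apply_coe, map_pow]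

lemma ffHyp_two_three_quarters (hF : ringChar F ≠ 2) {η : MulChar F ℂ} (hη : orderOf η = 3)
    (A : MulChar F ℂ) {χ : MulChar F ℂ} (hχ : χ ≠ 1) :
    ffHyp 2 ![A ^ 3, A⁻¹ ^ 3, χ⁻¹] ![quadCharC F, χ⁻¹ ^ 3] (3 / 4 : F) =
      A (-1) * ∑ B ∈ cubeFiber A,
        jacobiSum (B * χ) (B⁻¹ * χ) / jacobiSum (η * χ) (χ * η⁻¹) := by
  have h3 : (3 : F) ≠ 0 := by
    exact_mod_cast natCast_ne_zero_of_dvd_card_sub_one (hη ▸ MulChar.orderOf_dvd_card_sub_one F η)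
  have hden : ∏ i : Fin 2, jacobiSum (![A ^ 3, A⁻¹ ^ 3, χ⁻¹] i.succ)
      (![quadCharC F, χ⁻¹ ^ 3] i * (![A ^ 3, A⁻¹ ^ 3, χ⁻¹] i.succ)⁻¹) =
        jacobiSum (quadCharC F * A ^ 3) (A ^ 3)⁻¹ * (χ 27 * jacobiSum (η * χ) (χ * η⁻¹)) := by
    rw [← jacobiSum_inv_inv_sq_of_orderOf_eq_three hF (by simp [ringChar.eq_zero]) hη hχ,
      Fin.prod_univ_two, jacobiSum_comm (quadCharC F * A ^ 3)]
    change jacobiSum (A⁻¹ ^ 3) (quadCharC F * (A⁻¹ ^ 3)⁻¹) *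
      jacobiSum χ⁻¹ (χ⁻¹ ^ 3 * χ⁻¹⁻¹) = _
    rw [inv_pow A, inv_inv, pow_succ χ⁻¹ 2, mul_inv_cancel_right]
  have hJ : jacobiSum (quadCharC F * A ^ 3) (A ^ 3)⁻¹ ≠ 0 := by
    have h := jacobiSum_ne_zero (Nat.cast_ne_zero.mpr Fintype.card_ne_zero)
      (AddChar.FiniteField.primitiveChar_to_Complex_isPrimitive F) (quadCharC_ne_one hF) (A ^ 3)⁻¹
    rw [jacobiSum_quadCharC_inv] at h
    exact right_ne_zero_of_mul h
  have hχ27 : χ (-27) * χ (-1) = χ 27 := by rw [← map_mul]; norm_num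
  have hχ27_ne : χ 27 ≠ 0 := by
    rw [show (27 : F) = 3 ^ 3 by norm_num]
    exact MulChar.apply_ne_zero_iff.mpr (pow_ne_zero 3 h3).isUnit
  rw [ffHyp, hden, inv_pow A, ffPeriod_two_three_quarters hF h3, sum_units_eq_sum_cubeFiber hη,
    ← Finset.sum_div, one_div, ← div_eq_inv_mul, mul_div_mul_left _ _ hJ,
    mul_comm (A (-1)), mul_assoc (χ (-1)), ← mul_assoc, hχ27, mul_div_mul_left _ _ hχ27_ne,
    mul_div_assoc]

end PeriodFunctions

theorem mainTheorem5_general {F : Type*} [Field F] [Fintype F] [DecidableEq F]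
    (hF : ringChar F ≠ 2) (A χ η₃ : MulChar F ℂ) (hη₃ : orderOf η₃ = 3)
    (hA : A ^ 3 ≠ 1) (hχ : χ ^ 2 ≠ 1) :
    ffHyp 2 ![A ^ 3, A⁻¹ ^ 3, χ⁻¹] ![quadCharC F, χ⁻¹ ^ 3] (3 / 4 : F) =
        ∑ B ∈ cubeFiber A,
          (jacobiSum (B * χ) η₃ * jacobiSum (B⁻¹ * χ) η₃⁻¹) /
            (jacobiSum B (χ * η₃) * jacobiSum B⁻¹ (χ * η₃⁻¹)) ∧
      ∑ B ∈ cubeFiber A,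
          (jacobiSum (B * χ) η₃ * jacobiSum (B⁻¹ * χ) η₃⁻¹) /
            (jacobiSum B (χ * η₃) * jacobiSum B⁻¹ (χ * η₃⁻¹)) =
        A (-1) * ∑ B ∈ cubeFiber A,
          jacobiSum (B * χ) (B⁻¹ * χ) / jacobiSum (η₃ * χ) (χ * η₃⁻¹) := by
  have hη₃_neg_one : η₃ (-1) = 1 :=
    MulChar.val_neg_one_eq_one_of_odd_order (n := 3) (by decide) (hη₃ ▸ pow_orderOf_eq_one η₃)
  have hη₃_ne : η₃ ≠ 1 := fun h => by simp [h] at hη₃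
  have hχ_ne : χ ≠ 1 := fun h => hχ (by rw [h, one_pow])
  have hratio (B : MulChar F ℂ) (hB : B ∈ cubeFiber A) :
      jacobiSum (B * χ) η₃ * jacobiSum (B⁻¹ * χ) η₃⁻¹ /
          (jacobiSum B (χ * η₃) * jacobiSum B⁻¹ (χ * η₃⁻¹)) =
        A (-1) * (jacobiSum (B * χ) (B⁻¹ * χ) / jacobiSum (η₃ * χ) (χ * η₃⁻¹)) := by
    have hB_ne : B ≠ 1 := fun h => hA (by rw [← mem_cubeFiber.mp hB, h, one_pow])
    rw [jacobiSum_mul_jacobiSum_div_eq (Nat.cast_ne_zero.mpr Fintype.card_ne_zero)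
      (AddChar.FiniteField.primitiveChar_to_Complex_isPrimitive F) hB_ne hη₃_ne hχ,
      hη₃_neg_one, one_mul, apply_neg_one_of_mem_cubeFiber hB]
  have hsum := Finset.sum_congr rfl hratio
  rw [← Finset.mul_sum] at hsum
  exact ⟨(ffHyp_two_three_quarters hF hη₃ A hχ_ne).trans hsum.symm, hsum⟩

theorem mainTheorem5 {F : Type*} [Field F] [Fintype F] [DecidableEq F]
    (hq : Fintype.card F ≡ 1 [MOD 6])
    (A χ η₃ : MulChar F ℂ) (hη₃ : orderOf η₃ = 3)
    (hA : A ^ 6 ≠ 1) (hχ : χ ^ 6 ≠ 1)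
    (hAχ : (A * χ) ^ 3 ≠ 1) (hAχ' : (A⁻¹ * χ) ^ 3 ≠ 1) :
    ffHyp 2 ![A ^ 3, A⁻¹ ^ 3, χ⁻¹] ![quadCharC F, χ⁻¹ ^ 3] (3 / 4 : F) =
        ∑ B ∈ cubeFiber A,
          (jacobiSum (B * χ) η₃ * jacobiSum (B⁻¹ * χ) η₃⁻¹) /
            (jacobiSum B (χ * η₃) * jacobiSum B⁻¹ (χ * η₃⁻¹)) ∧
      ∑ B ∈ cubeFiber A,
          (jacobiSum (B * χ) η₃ * jacobiSum (B⁻¹ * χ) η₃⁻¹) /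
            (jacobiSum B (χ * η₃) * jacobiSum B⁻¹ (χ * η₃⁻¹)) =
        A (-1) * ∑ B ∈ cubeFiber A,
          jacobiSum (B * χ) (B⁻¹ * χ) / jacobiSum (η₃ * χ) (χ * η₃⁻¹) :=
  mainTheorem5_general (fun h => by have := FiniteField.even_card_of_char_two h; grind [Nat.ModEq])
    A χ η₃ hη₃ (fun h => hA (by rw [show 6 = 3 * 2 from rfl, pow_mul, h, one_pow]))
    fun h => hχ (by rw [show 6 = 2 * 3 from rfl, pow_mul, h, one_pow])
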